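/- Let $q$ be a power of a prime $p$, let $A=\mathbb{F}_q[\theta]$ and $K=\mathbb{F}_q(\theta)$, and let $t,u$ be two further indeterminates. For $a\in A$ let $\rho_a\in A[Y]$ be the Carlitz polynomial of $a$, that is, $a\mapsto\rho_a$ is $\mathbb{F}_q$-linear, $\rho_1=Y$, $\rho_\theta=\theta Y+Y^q$ and $\rho_{ab}=\rho_a\circ\rho_b$; for $a$ monic put $u_a=1/\rho_a(1/u)\in u^{q^{\deg a}}A[[u]]$. Let $$g=1-(\theta^q-\theta)\sum_{a\in A\text{ monic}}u_a^{q-1},\qquad h=-\sum_{a\in A\text{ monic}}a^q u_a,\qquad \Delta=-h^{q-1}$$ in $A[[u]]$ be the $u$-expansions of the normalised Eisenstein series of weight $q-1$ and type $0$ for $\mathbf{GL}_2(A)$, of the Poincaré series of weight $q+1$ and type $1$, and of the Drinfeld discriminant. Let $\tau$ be the endomorphism of $\mathbb{F}_q[t,\theta][[u]]$ that is $\mathbb{F}_q[t]$-linear and satisfies $\tau\theta=\theta^q$, $\tau u=u^q$ (acting coefficientwise on series in $u$). There is a unique $\boldsymbol{d}\in\mathbb{F}_q[t,\theta][[u]]$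 with $$(t-\theta^q)\,\Delta\,\tau^2\boldsymbol{d}+g\,\tau\boldsymbol{d}-\boldsymbol{d}=0$$ whose constant term as a series in $u$ is $1$. Let $L$ be any field extension of $\mathcal{R}=K((t))((u))\supset\mathbb{F}_q[t,\theta][[u]]$. For a subfield $k$ of $L$ write $k^{\mathrm{perf}}=\{x\in L: x^{p^n}\in k\text{ for some }n\ge 0\}$ for the perfect closure of $k$ in $L$, and $k^{\mathrm{alg}}$ for the set of elements of $L$ that are algebraic over $k$. Then: 1. $\boldsymbol{d}$ cannot be written as a finite sum $\lambda_1b_1+\cdots+\lambda_sb_s$ in $L$ with $\lambda_1,\ldots,\lambda_s\in\mathbb{F}_q((t))^{\mathrm{perf}}$ and $b_1,\ldots,b_s\in K((u))^{\mathrm{alg}}$; 2. $\boldsymbol{d}$ cannot be written as a finite sum $\mu_1b'_1+\cdots+\mu_sb'_s$ in $L$ with $\mu_1,\ldots,\mu_s\in K((u))^{\mathrm{perf}}$ and $b'_1,\ldots,b'_s\in\mathbb{F}_q((t))^{\mathrm{alg}}$. -/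

import Mathlib

open scoped Polynomial PowerSeries LaurentSeries

noncomputable section

namespace DrinfeldForms

variable (F : Type*) [Field F]

/-- The cardinality `q` of the finite field `F = 𝔽_q`. -/
def q : ℕ := Nat.card F

theorem one_lt_q [Finite F] : 1 < q F := Finite.one_lt_card

theorem q_ne_zero [Finite F] : q F ≠ 0 := (zero_lt_one.trans (one_lt_q F)).ne'

/-! ### The Carlitz module and the `u`-expansions of `g`, `h`, `Δ`

Here `A = F[X]`, the polynomial variable being `θ`, and `A⟦X⟧` is the ring of power series in `u`. -/

/-- The Carlitz polynomial `ρ_a ∈ A[Y]` of `a = ∑ aᵢ θⁱ`, namely `∑ aᵢ ρ_θ^{∘ i}`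
with `ρ_θ = θ Y + Y ^ q`. -/
def carlitz (a : F[X]) : F[X][X] :=
  a.sum fun i c =>
    Polynomial.C (Polynomial.C c) *
      (fun P : F[X][X] =>
        (Polynomial.C Polynomial.X * Polynomial.X + Polynomial.X ^ q F).comp P)^[i] Polynomial.X

/-- For `a` monic, `u_a = 1 / ρ_a (1 / u) = u ^ (q ^ deg a) / f_a (u)`, where
`f_a (u) = u ^ (q ^ deg a) * ρ_a (1 / u)` is the reciprocal polynomial of `ρ_a`,
whose constant term is `1`. -/
def uA (a : F[X]) : F[X]⟦X⟧ :=
  PowerSeries.X ^ (q F ^ a.natDegree) *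
    PowerSeries.invOfUnit ((carlitz F a).reverse : F[X]⟦X⟧) 1

/-- The sum `∑ φ a` over all monic `a ∈ A`, coefficient by coefficient in `u`. -/
def monicSum (φ : F[X] → F[X]⟦X⟧) : F[X]⟦X⟧ :=
  PowerSeries.mk fun n => ∑ᶠ a : {a : F[X] // a.Monic}, PowerSeries.coeff n (φ a)

/-- The `u`-expansion `g = 1 - [1] ∑ u_a ^ (q - 1)` of the normalised Eisenstein series of weight
`q - 1`, where `[1] = θ ^ q - θ`. -/
def g : F[X]⟦X⟧ :=
  1 - PowerSeries.C (Polynomial.X ^ q F - Polynomial.X) * monicSum F fun a => uA F a ^ (q F - 1)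

/-- The `u`-expansion `h = - ∑ a ^ q u_a` of the Poincaré series of weight `q + 1` and type `1`. -/
def h : F[X]⟦X⟧ :=
  - monicSum F fun a => PowerSeries.C (a ^ q F) * uA F a

/-- The `u`-expansion of `Δ = - h ^ (q - 1)`. -/
def Delta : F[X]⟦X⟧ := - h F ^ (q F - 1)

variable {F} in
theorem coeff_uA_of_lt [Finite F] {a : F[X]} {n : ℕ} (hn : n < q F ^ a.natDegree) :
    PowerSeries.coeff n (uA F a) = 0 := by
  rw [uA, PowerSeries.coeff_X_pow_mul', if_neg (not_le.2 hn)]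

/-- All but finitely many monic `a` have `u_a` divisible by `u ^ (n + 1)`, so that the
sums over the monic polynomials are finite in each degree. -/
theorem finite_monic_pow_le [Finite F] (n : ℕ) :
    {a : {a : F[X] // a.Monic} | q F ^ a.1.natDegree ≤ n}.Finite := by
  have hfin : (Polynomial.degreeLT F (n + 1) : Set F[X]).Finite := by
    have : Finite (Polynomial.degreeLT F (n + 1)) :=
      Finite.of_equiv _ (Polynomial.degreeLTEquiv F (n + 1)).symm.toEquiv
    exact Set.toFinite _
  refine (hfin.preimage (f := Subtype.val) Subtype.val_injective.injOn).subset ?_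
  intro a ha
  have h1 : a.1.natDegree < n + 1 :=
    Nat.lt_succ_of_lt ((Nat.lt_pow_self (one_lt_q F)).trans_le ha)
  simp only [Set.mem_preimage, SetLike.mem_coe, Polynomial.mem_degreeLT]
  exact (Polynomial.degree_le_natDegree).trans_lt (by exact_mod_cast h1)

theorem constantCoeff_uA [Finite F] (a : F[X]) : PowerSeries.constantCoeff (uA F a) = 0 := by
  rw [← PowerSeries.coeff_zero_eq_constantCoeff_apply]
  exact coeff_uA_of_lt (pow_pos (zero_lt_one.trans (one_lt_q F)) _)

theorem constantCoeff_g [Finite F] : PowerSeries.constantCoeff (g F) = 1 := by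
  have hq : q F - 1 ≠ 0 := Nat.sub_ne_zero_of_lt (one_lt_q F)
  simp [g, monicSum, constantCoeff_uA, hq]

theorem constantCoeff_h [Finite F] : PowerSeries.constantCoeff (h F) = 0 := by
  simp [h, monicSum, constantCoeff_uA]

theorem constantCoeff_Delta [Finite F] : PowerSeries.constantCoeff (Delta F) = 0 := by
  have hq : q F - 1 ≠ 0 := Nat.sub_ne_zero_of_lt (one_lt_q F)
  simp [Delta, constantCoeff_h, hq]

/-! ### The function `d`

The ring `𝔽_q[t, θ]` is `F[X][X]`; the inner variable is `θ`, the outer variable is `t`. -/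

variable [Finite F]

/-- The substitution `u ↦ u ^ n` in power series. -/
def expandHom {S : Type*} [CommRing S] (n : ℕ) (hn : n ≠ 0) : S⟦X⟧ →+* S⟦X⟧ :=
  (PowerSeries.expand n hn : S⟦X⟧ →ₐ[S] S⟦X⟧)

/-- The endomorphism `τ` of `𝔽_q[t, θ]⟦u⟧`: it fixes `𝔽_q[t]` and maps `θ` to `θ ^ q`
and `u` to `u ^ q`. -/
def tau : F[X][X]⟦X⟧ →+* F[X][X]⟦X⟧ :=
  (expandHom (q F) (q_ne_zero F)).comp
    (PowerSeries.map (Polynomial.mapRingHom (Polynomial.expand F (q F) : F[X] →+* F[X])))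

/-- The operator `X ↦ (t - θ ^ q) Δ (τ² X) + g (τ X)`. -/
def diffOp (f : F[X][X]⟦X⟧) : F[X][X]⟦X⟧ :=
  PowerSeries.C (Polynomial.X - Polynomial.C (Polynomial.X ^ q F)) *
      PowerSeries.map Polynomial.C (Delta F) * tau F (tau F f) +
    PowerSeries.map Polynomial.C (g F) * tau F f

/-- `f` solves `(t - θ ^ q) Δ (τ² f) + g (τ f) - f = 0` and has constant term `1`
in its `u`-expansion. -/
def IsD (f : F[X][X]⟦X⟧) : Prop :=
  diffOp F f - f = 0 ∧ PowerSeries.constantCoeff f = 1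

variable {F}

theorem coeff_tau_congr {f₁ f₂ : F[X][X]⟦X⟧} {n : ℕ}
    (hf : ∀ m, m ≤ n / q F → PowerSeries.coeff m f₁ = PowerSeries.coeff m f₂) :
    ∀ m, m ≤ n → PowerSeries.coeff m (tau F f₁) = PowerSeries.coeff m (tau F f₂) := by
  intro m hm
  simp only [tau, RingHom.comp_apply, expandHom, RingHom.coe_coe, PowerSeries.coeff_expand,
    PowerSeries.coeff_map]
  split_ifs
  · rw [hf _ (Nat.div_le_div_right hm)]
  · rfl

theorem coeff_mul_congr {R : Type*} [CommRing R] {e f₁ f₂ : R⟦X⟧} {n : ℕ}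
    (hf : ∀ m, m ≤ n → PowerSeries.coeff m f₁ = PowerSeries.coeff m f₂) :
    PowerSeries.coeff n (e * f₁) = PowerSeries.coeff n (e * f₂) := by
  rw [PowerSeries.coeff_mul, PowerSeries.coeff_mul]
  refine Finset.sum_congr rfl fun x hx => ?_
  rw [hf _ ((Finset.HasAntidiagonal.mem_antidiagonal.1 hx ▸ Nat.le_add_left _ _))]

theorem coeff_diffOp_congr {f₁ f₂ : F[X][X]⟦X⟧} {n : ℕ}
    (hf : ∀ m, m ≤ n / q F → PowerSeries.coeff m f₁ = PowerSeries.coeff m f₂) :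
    PowerSeries.coeff n (diffOp F f₁) = PowerSeries.coeff n (diffOp F f₂) := by
  have h1 := coeff_tau_congr hf
  have h2 : ∀ m, m ≤ n →
      PowerSeries.coeff m (tau F (tau F f₁)) = PowerSeries.coeff m (tau F (tau F f₂)) :=
    coeff_tau_congr fun m hm => h1 m (hm.trans (Nat.div_le_self _ _))
  simp only [diffOp, map_add]
  rw [coeff_mul_congr h1, coeff_mul_congr h2]

theorem constantCoeff_diffOp {f : F[X][X]⟦X⟧} (hf : PowerSeries.constantCoeff f = 1) :
    PowerSeries.constantCoeff (diffOp F f) = 1 := by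
  have hD : PowerSeries.constantCoeff (PowerSeries.map (Polynomial.C (R := F[X])) (Delta F)) = 0 := by
    rw [← PowerSeries.coeff_zero_eq_constantCoeff_apply, PowerSeries.coeff_map,
      PowerSeries.coeff_zero_eq_constantCoeff_apply, constantCoeff_Delta, map_zero]
  have hg : PowerSeries.constantCoeff (PowerSeries.map (Polynomial.C (R := F[X])) (g F)) = 1 := by
    rw [← PowerSeries.coeff_zero_eq_constantCoeff_apply, PowerSeries.coeff_map,
      PowerSeries.coeff_zero_eq_constantCoeff_apply, constantCoeff_g, map_one]
  have ht : PowerSeries.constantCoeff (tau F f) = 1 := by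
    rw [tau, RingHom.comp_apply, expandHom, RingHom.coe_coe, PowerSeries.constantCoeff_expand,
      ← PowerSeries.coeff_zero_eq_constantCoeff_apply, PowerSeries.coeff_map,
      PowerSeries.coeff_zero_eq_constantCoeff_apply, hf, map_one]
  simp only [diffOp, map_add, map_mul, hD, hg, ht]
  simp

variable (F)

theorem existsUnique_isD : ∃! f : F[X][X]⟦X⟧, IsD F f := by
  have hdiv : ∀ {n : ℕ}, n ≠ 0 → n / q F < n := fun hn =>
    Nat.div_lt_self (Nat.pos_of_ne_zero hn) (one_lt_q F)
  refine existsUnique_of_exists_of_unique ?_ ?_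
  · let s : ℕ → F[X][X]⟦X⟧ := fun k => (diffOp F)^[k] 1
    have hs : ∀ k, s (k + 1) = diffOp F (s k) := fun k => Function.iterate_succ_apply' _ _ _
    have h0 : ∀ k, PowerSeries.constantCoeff (s k) = 1 := by
      intro k
      induction k with
      | zero => simp [s]
      | succ k ih => rw [hs]; exact constantCoeff_diffOp ih
    have hstep : ∀ k m, m ≤ k → PowerSeries.coeff m (s (k + 1)) = PowerSeries.coeff m (s k) := by
      intro k
      induction k with
      | zero =>
        intro m hm
        obtain rfl : m = 0 := by omega
        simp only [PowerSeries.coeff_zero_eq_constantCoeff_apply, h0]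
      | succ k ih =>
        intro m hm
        rcases eq_or_ne m 0 with rfl | hm0
        · simp only [PowerSeries.coeff_zero_eq_constantCoeff_apply, h0]
        · rw [hs (k + 1)]
          conv_rhs => rw [hs k]
          exact coeff_diffOp_congr fun j hj => ih j (by have := hdiv hm0; omega)
    have hst : ∀ m k, PowerSeries.coeff m (s (m + k)) = PowerSeries.coeff m (s m) := by
      intro m k
      induction k with
      | zero => rfl
      | succ k ih => rw [← ih, ← add_assoc]; exact hstep _ _ (by omega)
    refine ⟨PowerSeries.mk fun n => PowerSeries.coeff n (s n), ?_, ?_⟩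
    · rw [sub_eq_zero]
      ext1 n
      rw [PowerSeries.coeff_mk, ← hstep n n le_rfl, hs]
      refine coeff_diffOp_congr fun m hm => ?_
      obtain ⟨k, rfl⟩ := Nat.exists_eq_add_of_le (hm.trans (Nat.div_le_self n (q F)))
      rw [PowerSeries.coeff_mk, hst]
    · rw [← PowerSeries.coeff_zero_eq_constantCoeff_apply, PowerSeries.coeff_mk,
        PowerSeries.coeff_zero_eq_constantCoeff_apply, h0]
  · rintro f₁ f₂ ⟨h1, c1⟩ ⟨h2, c2⟩
    rw [sub_eq_zero] at h1 h2
    ext1 n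
    induction n using Nat.strong_induction_on with
    | _ n ih =>
      rcases eq_or_ne n 0 with rfl | hn
      · simp only [PowerSeries.coeff_zero_eq_constantCoeff_apply, c1, c2]
      · rw [← h1, ← h2]
        exact coeff_diffOp_congr fun m hm => ih m (hm.trans_lt (hdiv hn))

/-- The function `d`, the unique solution of `IsD` in `𝔽_q[t, θ]⟦u⟧`. -/
def d : F[X][X]⟦X⟧ := (existsUnique_isD F).exists.choose

theorem isD_d : IsD F (d F) := (existsUnique_isD F).exists.choose_spec

end DrinfeldForms

namespace DrinfeldForms

/-! ### The fields `𝔽_q((t))` and `K((u))` inside `𝓡 = K((t))((u))` and its extensions -/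

/-- The ring homomorphism `k((x)) → k'((x))` that applies `φ : k → k'` to each coefficient. -/
def laurentMap {k k' : Type*} [Field k] [Field k'] (φ : k →+* k') : k⸨X⸩ →+* k'⸨X⸩ where
  toFun x := HahnSeries.map x φ
  map_zero' := by ext; simp
  map_one' := by ext n; simp [HahnSeries.coeff_one, apply_ite φ]
  map_add' x y := by ext; simp
  map_mul' x y := HahnSeries.map_mul (φ : k →ₙ+* k')

variable (F : Type*) [Field F] (K : Type*) [Field K] [Algebra F[X] K]

/-- `𝓡 = K((t))((u))`. -/
abbrev R : Type _ := K⸨X⸩⸨X⸩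

/-- The inclusion `𝔽_q((t)) → K((t)) → K((t))((u))`. -/
def ofFqT : F⸨X⸩ →+* R K :=
  (HahnSeries.C : K⸨X⸩ →+* R K).comp (laurentMap ((algebraMap F[X] K).comp Polynomial.C))

/-- The inclusion `K((u)) → K((t))((u))`. -/
def ofKU : K⸨X⸩ →+* R K :=
  laurentMap (HahnSeries.C : K →+* K⸨X⸩)

/-- The inclusion `𝔽_q[t, θ]⟦u⟧ → K((t))((u))`. -/
def ofSeries : F[X][X]⟦X⟧ →+* R K :=
  (HahnSeries.ofPowerSeries ℤ K⸨X⸩).comp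
    (PowerSeries.map
      (((HahnSeries.ofPowerSeries ℤ K).comp Polynomial.coeToPowerSeries.ringHom).comp
        (Polynomial.mapRingHom (algebraMap F[X] K))))

variable (L : Type*) [Field L] [Algebra (R K) L]

/-- The subfield `𝔽_q((t))` of an extension `L` of `𝓡`. -/
def FqT : Subfield L := RingHom.fieldRange ((algebraMap (R K) L).comp (ofFqT F K))

/-- The subfield `K((u))` of an extension `L` of `𝓡`. -/
def KU : Subfield L := RingHom.fieldRange ((algebraMap (R K) L).comp (ofKU K))

end DrinfeldForms

end

/-! Write d = ∑ c_j t^j with c_j ∈ A⟦u⟧. Comparing powers of t in the defining equation gives ord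
c_{j+1} = ord Δ + q² ord c_j, so these orders in u strictly increase (`order_tCoeff_d`). Hence the
matrix of coefficients of u^n t^j in d has triangular minors of every size with nonzero diagonal.
Its rank is infinite, and the same holds for every p^k-th power of d, whereas a sum of s products of
elements of K((u)) and K((t)) gives rank at most s (`ofSeries_d_pow_ne_sum`).

Both claims reduce to this. A p-power moves the factors in a perfect closure into the field itself,
and a further one makes the algebraic factors separable over 𝓡. A trace down to 𝓡 then replaces the
latter by elements of 𝓡 algebraic over the same subfield
(`exists_pow_eq_sum_of_mem_perfectClosure`). Such elements are known: those algebraic over K((u))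
lie in K((u)), and those algebraic over 𝔽_q((t)) lie in K((t)). -/

namespace DrinfeldForms

/-! ### Descent of algebraic coefficients -/

/-- If `x ∈ E` is a combination, with coefficients in `E`, of elements of `M` that are separable
over `E` and integral over `T`, then it is such a combination of elements of `E` integral
over `T`. -/
theorem exists_isIntegral_eq_sum_of_isSeparable {T E M : Type*} [Field T] [Field E] [Field M]
    [Algebra T E] [Algebra E M] [Algebra T M] [IsScalarTower T E M] {s : ℕ} (a : Fin s → E)
    (b : Fin s → M) (hb : ∀ i, IsIntegral T (b i)) (hsep : ∀ i, IsSeparable E (b i)) (x : E)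
    (hx : algebraMap E M x = ∑ i, algebraMap E M (a i) * b i) :
    ∃ m : Fin s → E, (∀ i, IsIntegral T (m i)) ∧ x = ∑ i, a i * m i := by
  have hint : ∀ y ∈ Set.range b, IsIntegral E y := by
    rintro _ ⟨i, rfl⟩
    exact (hb i).tower_top
  let N := IntermediateField.adjoin E (Set.range b)
  have : FiniteDimensional E N := IntermediateField.finiteDimensional_adjoin hint
  have : Algebra.IsSeparable E N :=
    (IntermediateField.isSeparable_adjoin_iff_isSeparable E M).2
      (by rintro _ ⟨i, rfl⟩; exact hsep i)
  let β : Fin s → N := fun i =>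
    ⟨b i, IntermediateField.subset_adjoin E (Set.range b) (Set.mem_range_self i)⟩
  have hβ : ∀ i, IsIntegral T (β i) := fun i =>
    (isIntegral_algHom_iff (N.val.restrictScalars T) N.val.injective).1 (hb i)
  -- The trace of x itself is [N : E] x, which may vanish in characteristic p, so x is first
  -- multiplied by some e of nonzero trace. The trace form of a separable extension is nonzero and
  -- products of the `b i` span N over E, so e can be taken integral over T.
  obtain ⟨e, he, htr⟩ : ∃ e : N, IsIntegral T e ∧ Algebra.trace E N e ≠ 0 := by
    by_contra! hcon
    refine Algebra.trace_ne_zero E N (LinearMap.ext fun y => ?_)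
    have hy : (y : M) ∈ Submodule.span E (Submonoid.closure (Set.range b) : Set M) := by
      rw [← Algebra.adjoin_eq_span, Subalgebra.mem_toSubmodule,
        ← IntermediateField.adjoin_toSubalgebra_of_isAlgebraic fun z hz => (hint z hz).isAlgebraic]
      exact y.2
    have key : ∀ z ∈ Submodule.span E (Submonoid.closure (Set.range b) : Set M),
        ∃ w : N, (w : M) = z ∧ Algebra.trace E N w = 0 := by
      intro z hz
      induction hz using Submodule.span_induction with
      | mem z hz =>
        have : ∃ w : N, (w : M) = z ∧ IsIntegral T w := by
          induction hz using Submonoid.closure_induction with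
          | mem z hz => obtain ⟨i, rfl⟩ := hz; exact ⟨β i, rfl, hβ i⟩
          | one => exact ⟨1, rfl, isIntegral_one⟩
          | mul z₁ z₂ _ _ h₁ h₂ =>
            obtain ⟨w₁, rfl, h₁⟩ := h₁
            obtain ⟨w₂, rfl, h₂⟩ := h₂
            exact ⟨w₁ * w₂, rfl, h₁.mul h₂⟩
        obtain ⟨w, hw, hi⟩ := this
        exact ⟨w, hw, hcon w hi⟩
      | zero => exact ⟨0, rfl, map_zero _⟩
      | add z₁ z₂ _ _ h₁ h₂ =>
        obtain ⟨w₁, rfl, h₁⟩ := h₁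
        obtain ⟨w₂, rfl, h₂⟩ := h₂
        exact ⟨w₁ + w₂, rfl, by rw [map_add, h₁, h₂, add_zero]⟩
      | smul r z _ h =>
        obtain ⟨w, rfl, h⟩ := h
        exact ⟨r • w, rfl, by rw [map_smul, h, smul_zero]⟩
    obtain ⟨w, hw, h0⟩ := key y hy
    rw [← Subtype.ext hw, h0, LinearMap.zero_apply]
  have hxN : algebraMap E N x = ∑ i, algebraMap E N (a i) * β i := by
    apply N.val.injective
    rw [map_sum]
    simpa using hx
  have htrace : Algebra.trace E N e * x = ∑ i, a i * Algebra.trace E N (β i * e) := by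
    have h := congrArg (fun y => Algebra.trace E N (y * e)) hxN
    simp only [Finset.sum_mul, map_sum, ← Algebra.smul_def, smul_mul_assoc, map_smul,
      smul_eq_mul] at h
    rw [mul_comm, h]
  -- Traces of T-integral elements are T-integral, and so are inverses, because T is a field.
  refine ⟨fun i => Algebra.trace E N (β i * e) * (Algebra.trace E N e)⁻¹, fun i =>
    (Algebra.isIntegral_trace ((hβ i).mul he)).mul
      (IsIntegral.inv (Algebra.isIntegral_trace he)), ?_⟩
  simp only [← mul_assoc, ← Finset.sum_mul]
  rw [← htrace, mul_comm, ← mul_assoc, inv_mul_cancel₀ htr, one_mul]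

/-- The minimal polynomial of y has the form f(X^(p^n)) with f separable, and y^(p^n) is a root of
f. -/
theorem exists_isSeparable_pow {E M : Type*} [Field E] [Field M] [Algebra E M] (p : ℕ)
    [ExpChar E p] {y : M} (hy : IsIntegral E y) : ∃ n : ℕ, IsSeparable E (y ^ p ^ n) := by
  obtain ⟨f, hf, n, hn⟩ := (minpoly.irreducible hy).hasSeparableContraction p
  refine ⟨n, hf.of_dvd (minpoly.dvd E _ ?_)⟩
  rw [← Polynomial.expand_aeval, hn, minpoly.aeval]

/-- If `x ∈ E` is a combination, with coefficients in `E`, of elements of an extension that are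
integral over `T`, then some `p`-power of `x` is a combination, with the corresponding powers of the
coefficients, of elements of `E` that are integral over `T`. -/
theorem exists_isIntegralElem_pow_eq_sum {T E M : Type*} [Field T] [Field E] [Field M]
    (φ : T →+* E) (ψ : E →+* M) (p : ℕ) [ExpChar E p] {s : ℕ} (a : Fin s → E) (b : Fin s → M)
    (hb : ∀ i, (ψ.comp φ).IsIntegralElem (b i)) (x : E) (hx : ψ x = ∑ i, ψ (a i) * b i) :
    ∃ (n : ℕ) (m : Fin s → E), (∀ i, φ.IsIntegralElem (m i)) ∧
      x ^ p ^ n = ∑ i, a i ^ p ^ n * m i := by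
  let := φ.toAlgebra
  let := ψ.toAlgebra
  let := (ψ.comp φ).toAlgebra
  have : IsScalarTower T E M := IsScalarTower.of_algebraMap_eq fun _ => rfl
  have : ExpChar M p := expChar_of_injective_ringHom ψ.injective p
  have hint : ∀ i, IsIntegral T (b i) := hb
  choose k hk using fun i => exists_isSeparable_pow (E := E) p (hint i).tower_top
  -- Any common upper bound of the `k i` would do, since powers of separable elements are separable.
  let n := ∑ i, k i
  have hsep : ∀ i, IsSeparable E (b i ^ p ^ n) := by
    intro i
    obtain ⟨r, hr⟩ := Nat.exists_eq_add_of_le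
      (Finset.single_le_sum (f := k) (fun _ _ => Nat.zero_le _) (Finset.mem_univ i))
    rw [show n = k i + r from hr, pow_add, pow_mul]
    exact (mem_separableClosure_iff (F := E)).1
      (pow_mem ((mem_separableClosure_iff (F := E)).2 (hk i)) _)
  obtain ⟨m, hm, he⟩ := exists_isIntegral_eq_sum_of_isSeparable (T := T)
    (fun i => a i ^ p ^ n) (fun i => b i ^ p ^ n) (fun i => (hint i).pow _) hsep (x ^ p ^ n) (by
      have h := congrArg (fun y => y ^ p ^ n) hx
      simp only [sum_pow_char_pow, mul_pow] at h
      simp only [map_pow]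
      exact h)
  exact ⟨n, m, hm, he⟩

/-- An element integral over the range of a field embedding is integral over its source. -/
theorem isIntegralElem_of_isIntegral_fieldRange {T M : Type*} [Field T] [Field M] (ψ : T →+* M)
    {y : M} (hy : IsIntegral ψ.fieldRange y) : ψ.IsIntegralElem y := by
  obtain ⟨f, hf, h0⟩ := hy
  obtain ⟨f', rfl⟩ := Polynomial.map_surjective ψ.rangeRestrictField
    ψ.rangeRestrictField_bijective.2 f
  refine ⟨f', ψ.rangeRestrictField_bijective.1.monic_map_iff.2 hf, ?_⟩
  rw [Polynomial.eval₂_map] at h0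
  exact h0

/-! ### Algebraic elements of fields of Laurent series -/

/-- A Laurent series is a power series, or its inverse is one without constant term. -/
theorem exists_ofPowerSeries_eq_or_inv {k : Type*} [Field k] (x : k⸨X⸩) :
    (∃ y : k⟦X⟧, x = HahnSeries.ofPowerSeries ℤ k y) ∨
      ∃ y : k⟦X⟧, PowerSeries.constantCoeff y = 0 ∧ x⁻¹ = HahnSeries.ofPowerSeries ℤ k y := by
  rcases eq_or_ne x 0 with rfl | hx
  · exact Or.inl ⟨0, by simp⟩
  have hx' := x.single_order_mul_powerSeriesPart
  rcases le_or_gt 0 x.order with h | h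
  · obtain ⟨n, hn⟩ := Int.eq_ofNat_of_zero_le h
    refine Or.inl ⟨PowerSeries.X ^ n * x.powerSeriesPart, ?_⟩
    rw [LaurentSeries.X_order_mul_powerSeriesPart hn.symm]
  · obtain ⟨n, hn⟩ := Int.eq_ofNat_of_zero_le (a := -x.order) (by omega)
    have hc : PowerSeries.constantCoeff x.powerSeriesPart ≠ 0 := by
      rw [← PowerSeries.coeff_zero_eq_constantCoeff_apply, LaurentSeries.powerSeriesPart_coeff]
      simpa using HahnSeries.coeff_order_eq_zero.not.2 hx
    refine Or.inr ⟨PowerSeries.X ^ n * x.powerSeriesPart⁻¹, ?_, ?_⟩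
    · have : n ≠ 0 := by omega
      simp [this]
    · refine inv_eq_of_mul_eq_one_right ?_
      conv_lhs => enter [1]; rw [← hx']
      have h1 : HahnSeries.ofPowerSeries ℤ k x.powerSeriesPart *
          HahnSeries.ofPowerSeries ℤ k x.powerSeriesPart⁻¹ = 1 := by
        rw [← map_mul, PowerSeries.mul_inv_cancel _ hc, map_one]
      rw [map_mul, HahnSeries.ofPowerSeries_X_pow, ← hn, mul_mul_mul_comm, h1, mul_one,
        HahnSeries.single_mul_single]
      simp

theorem algebraMap_eq_C (k : Type*) [Field k] : algebraMap k k⸨X⸩ = HahnSeries.C :=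
  RingHom.ext fun c => HahnSeries.ofPowerSeries_C c

/-- The minimal polynomial of a nonzero element has nonzero constant term, but setting x = 0 in the
relation f(y) = 0 gives f(0) = 0. -/
theorem eq_zero_of_isIntegral_of_constantCoeff {k : Type*} [Field k] {y : k⟦X⟧}
    (hy : IsIntegral k (HahnSeries.ofPowerSeries ℤ k y))
    (h0 : PowerSeries.constantCoeff y = 0) : y = 0 := by
  by_contra hne
  have hne' : HahnSeries.ofPowerSeries ℤ k y ≠ 0 :=
    (map_ne_zero_iff _ HahnSeries.ofPowerSeries_injective).2 hne
  refine minpoly.coeff_zero_ne_zero hy hne' ?_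
  set f := minpoly k (HahnSeries.ofPowerSeries ℤ k y)
  have h1 : Polynomial.aeval (HahnSeries.ofPowerSeries ℤ k y) f = 0 := minpoly.aeval _ _
  have h2 : HahnSeries.ofPowerSeries ℤ k (Polynomial.eval₂ PowerSeries.C y f) = 0 := by
    rw [Polynomial.hom_eval₂, ← h1, Polynomial.aeval_def]
    congr 1
  have h3 := (map_eq_zero_iff _ HahnSeries.ofPowerSeries_injective).1 h2
  have h4 := congrArg PowerSeries.constantCoeff h3
  rw [Polynomial.hom_eval₂, h0, map_zero, Polynomial.eval₂_at_zero] at h4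
  simpa using h4

/-- The field `k` is algebraically closed in `k((x))`. -/
theorem exists_eq_C_of_isIntegral {k : Type*} [Field k] {x : k⸨X⸩} (hx : IsIntegral k x) :
    ∃ c : k, x = HahnSeries.C c := by
  rcases exists_ofPowerSeries_eq_or_inv x with ⟨y, rfl⟩ | ⟨y, hy, hxy⟩
  · refine ⟨PowerSeries.constantCoeff y, ?_⟩
    have h := eq_zero_of_isIntegral_of_constantCoeff
      (y := y - PowerSeries.C (PowerSeries.constantCoeff y)) ?_ (by simp)
    · rw [← HahnSeries.ofPowerSeries_C, ← sub_eq_zero.1 h]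
    · rw [map_sub, HahnSeries.ofPowerSeries_C, ← algebraMap_eq_C]
      exact hx.sub isIntegral_algebraMap
  -- A pole is impossible: the inverse would be algebraic without constant term, hence zero.
  · have h := eq_zero_of_isIntegral_of_constantCoeff (hxy ▸ hx.inv) hy
    rw [h, map_zero, inv_eq_zero] at hxy
    exact ⟨0, by simp [hxy]⟩

/-- If `k` is algebraically closed in `k'` and `y ∈ k'⟦x⟧` is algebraic over `k⟦x⟧`, then the
coefficients of `y` are in `k`. -/
theorem coeff_mem_range_of_eval₂_eq_zero {k k' : Type*} [Field k] [Field k'] (φ : k →+* k')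
    (hφ : ∀ z : k', φ.IsIntegralElem z → z ∈ φ.range) (n : ℕ) :
    ∀ (y : k'⟦X⟧) (f : k⟦X⟧[X]), f ≠ 0 → f.eval₂ (PowerSeries.map φ) y = 0 →
      PowerSeries.coeff n y ∈ φ.range := by
  have hconst : ∀ (y : k'⟦X⟧) (f : k⟦X⟧[X]), f ≠ 0 → f.eval₂ (PowerSeries.map φ) y = 0 →
      PowerSeries.constantCoeff y ∈ φ.range := by
    intro y f hf h0
    have hu : ¬ IsUnit (Polynomial.C (PowerSeries.X : k⟦X⟧)) := by
      rw [Polynomial.isUnit_C]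
      exact PowerSeries.X_prime.not_isUnit
    -- Removing the largest power of x from f leaves a relation that stays nontrivial modulo x, so
    -- the constant term of y is algebraic over k.
    obtain ⟨g, hfg, hg⟩ :=
      (FiniteMultiplicity.of_not_isUnit hu hf).exists_eq_pow_mul_and_not_dvd
    rw [hfg, Polynomial.eval₂_mul, ← map_pow, Polynomial.eval₂_C, map_pow, PowerSeries.map_X] at h0
    have hg0 := (mul_eq_zero.1 h0).resolve_left (pow_ne_zero _ PowerSeries.X_ne_zero)
    have hgm : g.map PowerSeries.constantCoeff ≠ 0 := by
      intro h
      refine hg ((Polynomial.C_dvd_iff_dvd_coeff _ _).2 fun i => PowerSeries.X_dvd_iff.2 ?_)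
      rw [← Polynomial.coeff_map, h, Polynomial.coeff_zero]
    have h1 : (g.map PowerSeries.constantCoeff).eval₂ φ (PowerSeries.constantCoeff y) = 0 := by
      have h2 := congrArg PowerSeries.constantCoeff hg0
      rw [Polynomial.hom_eval₂, map_zero] at h2
      rw [Polynomial.eval₂_map, ← h2]
      congr 1
    let := φ.toAlgebra
    exact hφ _ (isAlgebraic_iff_isIntegral.1 ⟨_, hgm, h1⟩ : IsIntegral k _)
  induction n with
  | zero => simpa using hconst
  | succ n ih =>
    intro y f hf h0
    obtain ⟨c, hc⟩ := hconst y f hf h0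
    obtain ⟨z, hz⟩ : PowerSeries.X ∣ y - PowerSeries.C (φ c) :=
      PowerSeries.X_dvd_iff.2 (by simp [hc])
    have hyz : y = PowerSeries.X * z + PowerSeries.C (φ c) := by rw [← hz]; ring
    have hcoeff : PowerSeries.coeff (n + 1) y = PowerSeries.coeff n z := by
      rw [hyz, map_add, PowerSeries.coeff_succ_X_mul, PowerSeries.coeff_C,
        if_neg n.succ_ne_zero, add_zero]
    rw [hcoeff]
    -- With y = x z + φ(c), the substitution Y ↦ x Y + c turns a relation for y into one for z,
    -- whose coefficients are those of y shifted by one. It has degree 1 in Y, so the relation stays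
    -- nonzero.
    let l : k⟦X⟧[X] := Polynomial.C PowerSeries.X * Polynomial.X + Polynomial.C (PowerSeries.C c)
    refine ih z (f.comp l) ?_ ?_
    · intro h
      have hl : l.natDegree = 1 := Polynomial.natDegree_linear PowerSeries.X_ne_zero
      rcases Polynomial.comp_eq_zero_iff.1 h with h | ⟨-, h⟩
      · exact hf h
      · rw [h, Polynomial.natDegree_C] at hl
        exact zero_ne_one hl
    · rw [Polynomial.eval₂_comp]
      have hl : l.eval₂ (PowerSeries.map φ) z = y := by
        rw [hyz]
        simp [l]
      rw [hl, h0]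

@[simp]
theorem coeff_laurentMap {k k' : Type*} [Field k] [Field k'] (φ : k →+* k') (x : k⸨X⸩) (n : ℤ) :
    (laurentMap φ x).coeff n = φ (x.coeff n) := rfl

theorem laurentMap_ofPowerSeries {k k' : Type*} [Field k] [Field k'] (φ : k →+* k') (y : k⟦X⟧) :
    laurentMap φ (HahnSeries.ofPowerSeries ℤ k y) =
      HahnSeries.ofPowerSeries ℤ k' (PowerSeries.map φ y) := by
  ext n
  rw [coeff_laurentMap]
  rcases le_or_gt 0 n with h | h
  · obtain ⟨m, rfl⟩ := Int.eq_ofNat_of_zero_le h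
    simp
  · have hn : n ∉ Set.range (Nat.cast : ℕ → ℤ) := by rintro ⟨m, rfl⟩; omega
    rw [HahnSeries.ofPowerSeries_apply, HahnSeries.ofPowerSeries_apply,
      HahnSeries.embDomain_of_notMem_range hn, HahnSeries.embDomain_of_notMem_range hn, map_zero]

theorem laurentMap_single {k k' : Type*} [Field k] [Field k'] (φ : k →+* k') (n : ℤ) :
    laurentMap φ (HahnSeries.single n 1) = HahnSeries.single n 1 := by
  ext m
  simp [HahnSeries.coeff_single, apply_ite φ]

/-- If `k` is algebraically closed in `k'`, then `k((x))` is algebraically closed in `k'((x))`. -/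
theorem mem_range_laurentMap_of_isIntegralElem {k k' : Type*} [Field k] [Field k'] (φ : k →+* k')
    (hφ : ∀ z : k', φ.IsIntegralElem z → z ∈ φ.range) {y : k'⸨X⸩}
    (hy : (laurentMap φ).IsIntegralElem y) : y ∈ (laurentMap φ).range := by
  let : Algebra k⸨X⸩ k'⸨X⸩ := (laurentMap φ).toAlgebra
  let : Algebra k⟦X⟧ k'⸨X⸩ := ((laurentMap φ).comp (algebraMap k⟦X⟧ k⸨X⸩)).toAlgebra
  have : IsScalarTower k⟦X⟧ k⸨X⸩ k'⸨X⸩ := IsScalarTower.of_algebraMap_eq fun _ => rfl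
  set w := y.powerSeriesPart with hw
  have hyw : laurentMap φ (HahnSeries.single y.order 1) * HahnSeries.ofPowerSeries ℤ k' w = y := by
    rw [laurentMap_single, LaurentSeries.single_order_mul_powerSeriesPart]
  have hwy : HahnSeries.ofPowerSeries ℤ k' w =
      algebraMap k⸨X⸩ k'⸨X⸩ (HahnSeries.single (-y.order) 1) * y := by
    rw [LaurentSeries.ofPowerSeries_powerSeriesPart]
    congr 1
    exact (laurentMap_single φ _).symm
  have hint : IsIntegral k⸨X⸩ (HahnSeries.ofPowerSeries ℤ k' w) :=
    hwy ▸ isIntegral_algebraMap.mul hy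
  -- Denominators are cleared to get a relation over k⟦x⟧, at the price of monicity.
  obtain ⟨f, hf, h0⟩ := (IsFractionRing.isAlgebraic_iff k⟦X⟧ k⸨X⸩ k'⸨X⸩).2 hint.isAlgebraic
  have h1 : f.eval₂ (PowerSeries.map φ) w = 0 := by
    apply HahnSeries.ofPowerSeries_injective (Γ := ℤ)
    rw [Polynomial.hom_eval₂, map_zero, ← h0, Polynomial.aeval_def]
    congr 1
    ext1 c
    exact (laurentMap_ofPowerSeries φ c).symm
  choose c hc using fun n => coeff_mem_range_of_eval₂_eq_zero φ hφ n w f hf h1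
  refine ⟨HahnSeries.single y.order 1 * HahnSeries.ofPowerSeries ℤ k (PowerSeries.mk c), ?_⟩
  rw [map_mul, laurentMap_ofPowerSeries]
  conv_rhs => rw [← hyw]
  congr 2
  ext n
  rw [PowerSeries.coeff_map, PowerSeries.coeff_mk, hc]

/-! ### The discriminant does not vanish -/

theorem uA_one (F : Type*) [Field F] : uA F 1 = PowerSeries.X := by
  have hc : carlitz F 1 = Polynomial.X := by
    rw [carlitz, ← Polynomial.C_1, Polynomial.sum_C_index (by simp)]
    simp
  have hr : (Polynomial.X : F[X][X]).reverse = 1 := by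
    rw [← mul_one Polynomial.X, Polynomial.reverse_X_mul, ← Polynomial.C_1, Polynomial.reverse_C]
  have hi : PowerSeries.invOfUnit (1 : F[X]⟦X⟧) 1 = 1 := by
    have h := PowerSeries.mul_invOfUnit (1 : F[X]⟦X⟧) 1 (by simp)
    rwa [one_mul] at h
  rw [uA, hc, hr, Polynomial.coe_one, hi]
  simp

/-- Only a = 1 contributes, since u_a is divisible by u^(q^deg a). This is what makes Δ nonzero. -/
theorem coeff_one_h (F : Type*) [Field F] [Finite F] : PowerSeries.coeff 1 (h F) = -1 := by
  rw [h, monicSum, map_neg, PowerSeries.coeff_mk,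
    finsum_eq_single _ (⟨1, Polynomial.monic_one⟩ : {a : F[X] // a.Monic})]
  · simp [uA_one]
  · rintro ⟨a, ha⟩ hne
    have hdeg : a.natDegree ≠ 0 := fun h0 =>
      hne (Subtype.ext (Polynomial.eq_one_of_monic_natDegree_zero ha h0))
    rw [PowerSeries.coeff_C_mul, coeff_uA_of_lt (Nat.one_lt_pow hdeg (one_lt_q F)), mul_zero]

theorem Delta_ne_zero (F : Type*) [Field F] [Finite F] : Delta F ≠ 0 := by
  have hh : h F ≠ 0 := fun h0 => by simpa [h0] using coeff_one_h F
  exact neg_ne_zero.2 (pow_ne_zero _ hh)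

/-! ### The coefficients of `d` with respect to `t` -/

/-- The coefficient of `t ^ j` of a series in `S[t]⟦u⟧`. -/
noncomputable def tCoeff {S : Type*} [CommRing S] (j : ℕ) : S[X]⟦X⟧ →+ S⟦X⟧ where
  toFun f := PowerSeries.mk fun n => (PowerSeries.coeff n f).coeff j
  map_zero' := by ext; simp
  map_add' f g := by ext; simp

@[simp]
theorem coeff_tCoeff {S : Type*} [CommRing S] (j n : ℕ) (f : S[X]⟦X⟧) :
    PowerSeries.coeff n (tCoeff j f) = (PowerSeries.coeff n f).coeff j :=
  PowerSeries.coeff_mk n fun n => (PowerSeries.coeff n f).coeff j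

theorem tCoeff_map_C_mul {S : Type*} [CommRing S] (j : ℕ) (a : S⟦X⟧) (f : S[X]⟦X⟧) :
    tCoeff j (PowerSeries.map Polynomial.C a * f) = a * tCoeff j f := by
  ext n
  simp [PowerSeries.coeff_mul, Polynomial.finsetSum_coeff]

theorem tCoeff_succ_X_mul {S : Type*} [CommRing S] (j : ℕ) (f : S[X]⟦X⟧) :
    tCoeff (j + 1) (PowerSeries.C Polynomial.X * f) = tCoeff j f := by
  ext n
  simp [Polynomial.coeff_X_mul]

theorem coeff_coeff_ofSeries (F K : Type*) [Field F] [Field K] [Algebra F[X] K]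
    (f : F[X][X]⟦X⟧) (n j : ℕ) :
    ((ofSeries F K f).coeff (n : ℤ)).coeff (j : ℤ) =
      algebraMap F[X] K ((PowerSeries.coeff n f).coeff j) := by
  simp [ofSeries]

variable (F : Type*) [Field F] [Finite F]

/-- The endomorphism of `𝔽_q[θ]⟦u⟧` induced by `τ`. -/
noncomputable def tauA : F[X]⟦X⟧ →+* F[X]⟦X⟧ :=
  (expandHom (q F) (q_ne_zero F)).comp
    (PowerSeries.map (Polynomial.expand F (q F) : F[X] →+* F[X]))

theorem tCoeff_tau (j : ℕ) (f : F[X][X]⟦X⟧) : tCoeff j (tau F f) = tauA F (tCoeff j f) := by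
  ext1 n
  rw [coeff_tCoeff]
  simp only [tau, tauA, RingHom.comp_apply, expandHom, RingHom.coe_coe, PowerSeries.coeff_expand,
    PowerSeries.coeff_map]
  split_ifs
  · simp
  · simp

theorem order_map_of_injective {A B : Type*} [Semiring A] [Semiring B] (φ : A →+* B)
    (hφ : Function.Injective φ) (f : A⟦X⟧) : (PowerSeries.map φ f).order = f.order := by
  refine le_antisymm ?_ ?_
  · refine PowerSeries.le_order _ _ fun i hi => hφ ?_
    rw [map_zero, ← PowerSeries.coeff_map]
    exact PowerSeries.coeff_of_lt_order _ hi
  · refine PowerSeries.le_order _ _ fun i hi => ?_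
    rw [PowerSeries.coeff_map, PowerSeries.coeff_of_lt_order _ hi, map_zero]

theorem order_tauA (f : F[X]⟦X⟧) : (tauA F f).order = q F * f.order := by
  rw [tauA, RingHom.comp_apply, expandHom, RingHom.coe_coe, PowerSeries.order_expand,
    order_map_of_injective (Polynomial.expand F (q F) : F[X] →+* F[X])
      (Polynomial.expand_injective (Nat.pos_of_ne_zero (q_ne_zero F))), nsmul_eq_mul]

/-- This is the coefficient of t^(j+1) in the equation of d. As τ fixes t, only the t in the factor
t - θ^q links c_{j+1} to c_j. -/
theorem tCoeff_succ_d (j : ℕ) :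
    tCoeff (j + 1) (d F) + (PowerSeries.C (Polynomial.X ^ q F) * Delta F *
        tauA F (tauA F (tCoeff (j + 1) (d F))) - g F * tauA F (tCoeff (j + 1) (d F))) =
      Delta F * tauA F (tauA F (tCoeff j (d F))) := by
  have h0 := congrArg (tCoeff (j + 1)) (sub_eq_zero.1 (isD_d F).1)
  have h1 : PowerSeries.C (Polynomial.X - Polynomial.C (Polynomial.X ^ q F)) *
      PowerSeries.map Polynomial.C (Delta F) * tau F (tau F (d F)) =
      PowerSeries.C Polynomial.X * (PowerSeries.map Polynomial.C (Delta F) * tau F (tau F (d F)))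
      - PowerSeries.map Polynomial.C (PowerSeries.C (Polynomial.X ^ q F) * Delta F) *
        tau F (tau F (d F)) := by
    rw [map_mul (PowerSeries.map Polynomial.C), PowerSeries.map_C, map_sub]
    ring
  rw [diffOp, map_add, h1, map_sub, tCoeff_succ_X_mul, tCoeff_map_C_mul, tCoeff_map_C_mul,
    tCoeff_map_C_mul] at h0
  simp only [tCoeff_tau] at h0
  rw [← sub_eq_zero] at h0 ⊢
  linear_combination (-1 : F[X]⟦X⟧) * h0

/-- The orders in `u` of the coefficients of `d` with respect to `t` are finite and strictly
increasing. -/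
theorem order_tCoeff_d (j : ℕ) :
    tCoeff j (d F) ≠ 0 ∧ (tCoeff j (d F)).order < (tCoeff (j + 1) (d F)).order := by
  have hstep : ∀ j, tCoeff j (d F) ≠ 0 → tCoeff (j + 1) (d F) ≠ 0 ∧
      (tCoeff j (d F)).order < (tCoeff (j + 1) (d F)).order := by
    intro j hj
    have hrec := tCoeff_succ_d F j
    have hDelta : (Delta F).order ≠ 0 :=
      PowerSeries.order_ne_zero_iff_constCoeff_eq_zero.2 (constantCoeff_Delta F)
    have hDelta' : (Delta F).order ≠ ⊤ := PowerSeries.order_eq_top.not.2 (Delta_ne_zero F)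
    have hcj : (tCoeff j (d F)).order ≠ ⊤ := PowerSeries.order_eq_top.not.2 hj
    -- The constant term 1 of d involves no positive power of t. Positivity of the order is needed
    -- for τ to raise it strictly.
    have h0 : (tCoeff (j + 1) (d F)).order ≠ 0 := by
      rw [PowerSeries.order_ne_zero_iff_constCoeff_eq_zero,
        ← PowerSeries.coeff_zero_eq_constantCoeff_apply, coeff_tCoeff,
        PowerSeries.coeff_zero_eq_constantCoeff_apply, (isD_d F).2]
      simp [Polynomial.coeff_one]
    set c := tCoeff (j + 1) (d F)
    set b := tCoeff j (d F)
    have hr : (Delta F * tauA F (tauA F b)).order =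
        (Delta F).order + q F * (q F * b.order) := by
      rw [PowerSeries.order_mul, order_tauA, order_tauA]
    have hc : c ≠ 0 := by
      intro hc
      rw [hc] at hrec
      have h1 : (Delta F * tauA F (tauA F b)).order = ⊤ := by
        rw [← hrec]; simp
      rw [hr] at h1
      obtain ⟨w, hw⟩ := ENat.ne_top_iff_exists.1 hcj
      obtain ⟨v, hv⟩ := ENat.ne_top_iff_exists.1 hDelta'
      rw [← hw, ← hv] at h1
      norm_cast at h1
    refine ⟨hc, ?_⟩
    have hctop : c.order ≠ ⊤ := PowerSeries.order_eq_top.not.2 hc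
    -- Since τ multiplies orders by q, the term c dominates the left side of `hrec`. Therefore ord c
    -- = ord Δ + q² ord b, which exceeds ord b because ord Δ > 0.
    have hlt : c.order < (PowerSeries.C (Polynomial.X ^ q F) * Delta F * tauA F (tauA F c) -
        g F * tauA F c).order := by
      have h1 : c.order < q F * c.order := by
        obtain ⟨w, hw⟩ := ENat.ne_top_iff_exists.1 hctop
        rw [← hw] at h0 ⊢
        have : w ≠ 0 := by exact_mod_cast h0
        have := one_lt_q F
        norm_cast
        nlinarith [Nat.pos_of_ne_zero ‹w ≠ 0›]
      have h2 : (q F : ℕ∞) * c.order ≤ q F * (q F * c.order) := by gcongr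
      rw [sub_eq_add_neg]
      refine lt_of_lt_of_le (h1.trans_le (le_min ?_ ?_)) (PowerSeries.min_order_le_order_add _ _)
      · rw [PowerSeries.order_mul, order_tauA, order_tauA]
        exact h2.trans le_add_self
      · rw [PowerSeries.order_neg, PowerSeries.order_mul, order_tauA]
        exact le_add_self
    have hord := PowerSeries.order_add_of_order_ne _ _ hlt.ne
    rw [hrec, hr, inf_eq_left.2 hlt.le] at hord
    rw [← hord]
    obtain ⟨w, hw⟩ := ENat.ne_top_iff_exists.1 hcj
    obtain ⟨v, hv⟩ := ENat.ne_top_iff_exists.1 hDelta'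
    rw [← hv] at hDelta ⊢
    rw [← hw]
    have hv0 : v ≠ 0 := by exact_mod_cast hDelta
    have := one_lt_q F
    norm_cast
    have h1 : w ≤ q F * w := Nat.le_mul_of_pos_left _ (by omega)
    have h2 : q F * w ≤ q F * (q F * w) := Nat.le_mul_of_pos_left _ (by omega)
    omega
  have hne : ∀ j, tCoeff j (d F) ≠ 0 := by
    intro j
    induction j with
    | zero =>
      intro h0
      have h1 := congrArg (PowerSeries.coeff 0) h0
      rw [coeff_tCoeff, PowerSeries.coeff_zero_eq_constantCoeff_apply, (isD_d F).2] at h1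
      simp at h1
    | succ j ih => exact (hstep j ih).1
  exact ⟨hne j, (hstep j (hne j)).2⟩

theorem exists_strictMono_coeff_d : ∃ v : ℕ → ℕ, StrictMono v ∧
    (∀ j, (PowerSeries.coeff (v j) (d F)).coeff j ≠ 0) ∧
    ∀ j n, n < v j → (PowerSeries.coeff n (d F)).coeff j = 0 := by
  have hv : ∀ j, (((tCoeff j (d F)).order.toNat : ℕ) : ℕ∞) = (tCoeff j (d F)).order := fun j =>
    ENat.natCast_toNat (PowerSeries.order_eq_top.not.2 (order_tCoeff_d F j).1)
  refine ⟨fun j => (tCoeff j (d F)).order.toNat, strictMono_nat_of_lt_succ fun j => ?_,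
    fun j => ?_, fun j n hn => ?_⟩
  · have := (order_tCoeff_d F j).2
    rw [← hv j, ← hv (j + 1)] at this
    exact_mod_cast this
  · rw [← coeff_tCoeff]
    exact PowerSeries.coeff_order (order_tCoeff_d F j).1
  · rw [← coeff_tCoeff]
    exact PowerSeries.coeff_of_lt_order_toNat _ hn

/-! ### The powers of `d` have infinite rank over `K((t))` and `K((u))` -/

/-- The p^k-th power of f is f(x^(p^k)) with the iterated Frobenius applied to its coefficients. -/
theorem coeff_pow_mul_pow {A : Type*} [CommRing A] (p : ℕ) [ExpChar A p] (f : A⟦X⟧) (k n : ℕ) :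
    PowerSeries.coeff (p ^ k * n) (f ^ p ^ k) = PowerSeries.coeff n f ^ p ^ k := by
  have hp : p ≠ 0 := expChar_ne_zero A p
  have h : PowerSeries.map (iterateFrobenius A p k)
      (PowerSeries.expand (p ^ k) (pow_ne_zero k hp) f) = f ^ p ^ k :=
    MvPowerSeries.map_iterateFrobenius_expand p hp f k
  rw [← h, PowerSeries.coeff_map, PowerSeries.coeff_expand_mul, iterateFrobenius_def]

theorem polynomial_coeff_pow_mul_pow {A : Type*} [CommRing A] (p : ℕ) [ExpChar A p] (f : A[X])
    (k n : ℕ) : (f ^ p ^ k).coeff (p ^ k * n) = f.coeff n ^ p ^ k := by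
  have hp : p ≠ 0 := expChar_ne_zero A p
  rw [← Polynomial.map_iterateFrobenius_expand, Polynomial.coeff_map, mul_comm (p ^ k) n,
    Polynomial.coeff_expand_mul (pow_pos (Nat.pos_of_ne_zero hp) k), iterateFrobenius_def]

variable (K : Type*) [Field K] [Algebra F[X] K]

/-- Such a sum would factor the coefficient matrix through K^s. Rows u^(p^k v_a) and columns t^(p^k
b) with a, b ≤ s give a triangular, invertible matrix of size s + 1, a contradiction. -/
theorem ofSeries_d_pow_ne_sum [IsFractionRing F[X] K] (p : ℕ) [ExpChar F p] (k s : ℕ)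
    (μ ν : Fin s → K⸨X⸩) :
    ofSeries F K (d F) ^ p ^ k ≠ ∑ i, ofKU K (μ i) * HahnSeries.C (ν i) := by
  intro heq
  have hp : 0 < p ^ k := pow_pos (expChar_pos F p) k
  have hentry : ∀ n j : ℕ, algebraMap F[X] K ((PowerSeries.coeff n (d F)).coeff j) ^ p ^ k =
      ∑ i, (μ i).coeff ((p ^ k * n : ℕ) : ℤ) * (ν i).coeff ((p ^ k * j : ℕ) : ℤ) := by
    intro n j
    rw [← map_pow, ← polynomial_coeff_pow_mul_pow p, ← coeff_pow_mul_pow p,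
      ← coeff_coeff_ofSeries, map_pow, heq, HahnSeries.coeff_sum, HahnSeries.coeff_sum]
    refine Finset.sum_congr rfl fun i _ => ?_
    rw [mul_comm, HahnSeries.C_mul_eq_smul, HahnSeries.coeff_smul, smul_eq_mul, mul_comm, ofKU,
      coeff_laurentMap, HahnSeries.C_mul_eq_smul, HahnSeries.coeff_smul, smul_eq_mul]
  obtain ⟨v, hv, hne, hlt⟩ := exists_strictMono_coeff_d F
  let P : Matrix (Fin (s + 1)) (Fin s) K :=
    Matrix.of fun a i => (μ i).coeff ((p ^ k * v a : ℕ) : ℤ)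
  let Q : Matrix (Fin s) (Fin (s + 1)) K :=
    Matrix.of fun i b => (ν i).coeff ((p ^ k * (b : ℕ) : ℕ) : ℤ)
  have hPQ : ∀ a b : Fin (s + 1), (P * Q) a b =
      algebraMap F[X] K ((PowerSeries.coeff (v a) (d F)).coeff b) ^ p ^ k := by
    intro a b
    rw [hentry, Matrix.mul_apply]
    rfl
  have htri : (P * Q).IsLowerTriangular := by
    intro a b hab
    rw [hPQ, hlt b (v a) (hv (OrderDual.toDual_lt_toDual.1 hab)), map_zero, zero_pow hp.ne']
  have hdet : (P * Q).det ≠ 0 := by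
    rw [Matrix.det_of_isLowerTriangular _ htri, Finset.prod_ne_zero_iff]
    intro a _
    rw [hPQ]
    exact pow_ne_zero _ ((map_ne_zero_iff _ (IsFractionRing.injective F[X] K)).2 (hne a))
  have hrank := Matrix.rank_of_isUnit (P * Q)
    ((Matrix.isUnit_iff_isUnit_det _).2 (isUnit_iff_ne_zero.2 hdet))
  have hle := (Matrix.rank_mul_le_left P Q).trans (Matrix.rank_le_width P)
  rw [hrank, Fintype.card_fin] at hle
  omega

/-! ### Algebraic elements of `K((t))((u))` -/

theorem mem_range_C_of_isIntegralElem {k : Type*} [Field k] {z : k⸨X⸩}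
    (hz : (HahnSeries.C : k →+* k⸨X⸩).IsIntegralElem z) :
    z ∈ (HahnSeries.C : k →+* k⸨X⸩).range := by
  obtain ⟨c, rfl⟩ := exists_eq_C_of_isIntegral (k := k) (x := z)
    (by rwa [IsIntegral, algebraMap_eq_C])
  exact ⟨c, rfl⟩

theorem exists_eq_ofKU_of_isIntegralElem (K : Type*) [Field K] {y : R K}
    (hy : (ofKU K).IsIntegralElem y) : ∃ z, y = ofKU K z := by
  obtain ⟨z, hz⟩ := mem_range_laurentMap_of_isIntegralElem _
    (fun _ => mem_range_C_of_isIntegralElem) hy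
  exact ⟨z, hz.symm⟩

/-- Integrality over the larger field K((t)) suffices, as this field is algebraically closed in
K((t))((u)). The rank argument needs no finer information. -/
theorem exists_eq_C_of_ofFqT_isIntegralElem (F K : Type*) [Field F] [Field K] [Algebra F[X] K]
    {y : R K} (hy : (ofFqT F K).IsIntegralElem y) : ∃ z : K⸨X⸩, y = HahnSeries.C z := by
  obtain ⟨f, hf, h0⟩ := hy
  have hy' : (HahnSeries.C : K⸨X⸩ →+* R K).IsIntegralElem y :=
    ⟨f.map (laurentMap ((algebraMap F[X] K).comp Polynomial.C)), hf.map _, by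
      rw [Polynomial.eval₂_map]; exact h0⟩
  obtain ⟨z, hz⟩ := mem_range_C_of_isIntegralElem hy'
  exact ⟨z, hz.symm⟩

/-! ### Reduction from sums in L to sums in 𝓡 -/

/-- Finitely many elements of the perfect closure of a subfield have a common `p`-power exponent
that brings them into the subfield. -/
theorem exists_pow_eq_of_mem_perfectClosure {T M : Type*} [Field T] [Field M] (ψ : T →+* M)
    (p : ℕ) [ExpChar T p] {s : ℕ} {x : Fin s → M}
    (hx : ∀ i, x i ∈ perfectClosure ψ.fieldRange M) :
    ∃ (n : ℕ) (y : Fin s → T), ∀ i, x i ^ p ^ n = ψ (y i) := by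
  have : ExpChar ψ.fieldRange p := expChar_of_injective_ringHom ψ.rangeRestrictField.injective p
  choose k hk using fun i => (mem_perfectClosure_iff_pow_mem p).1 (hx i)
  have hmem : ∀ i, x i ^ p ^ (∑ i, k i) ∈ ψ.fieldRange := by
    intro i
    obtain ⟨r, hr⟩ := Nat.exists_eq_add_of_le
      (Finset.single_le_sum (f := k) (fun _ _ => Nat.zero_le _) (Finset.mem_univ i))
    obtain ⟨z, hz⟩ := hk i
    rw [hr, pow_add, pow_mul, ← hz]
    exact pow_mem z.2 _
  choose y hy using hmem
  exact ⟨_, y, fun i => (hy i).symm⟩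

/-- If `x ∈ E` is a finite sum of products of an element of the perfect closure of `T₁` and an
element algebraic over `T₂`, then some `p`-power of `x` is a finite sum of products of an element
of `T₁` and an element of `E` algebraic over `T₂`. -/
theorem exists_pow_eq_sum_of_mem_perfectClosure {T₁ T₂ E M : Type*} [Field T₁] [Field T₂]
    [Field E] [Field M] (φ₁ : T₁ →+* E) (φ₂ : T₂ →+* E) (ψ : E →+* M) (p : ℕ) [ExpChar T₁ p]
    {s : ℕ} {a b : Fin s → M} (ha : ∀ i, a i ∈ perfectClosure (ψ.comp φ₁).fieldRange M)
    (hb : ∀ i, b i ∈ algebraicClosure (ψ.comp φ₂).fieldRange M) {x : E}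
    (hx : ψ x = ∑ i, a i * b i) :
    ∃ (n : ℕ) (y : Fin s → T₁) (m : Fin s → E), (∀ i, φ₂.IsIntegralElem (m i)) ∧
      x ^ p ^ n = ∑ i, φ₁ (y i) * m i := by
  have : ExpChar E p := expChar_of_injective_ringHom φ₁.injective p
  have : ExpChar M p := expChar_of_injective_ringHom ψ.injective p
  -- The power p^k brings the factors `a i` into T₁; the later power p^n makes the factors `b i`
  -- descend to E.
  obtain ⟨k, y, hy⟩ := exists_pow_eq_of_mem_perfectClosure (ψ.comp φ₁) p ha
  have hb' : ∀ i, (ψ.comp φ₂).IsIntegralElem (b i ^ p ^ k) := fun i =>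
    isIntegralElem_of_isIntegral_fieldRange _ ((mem_algebraicClosure_iff'.1 (hb i)).pow _)
  obtain ⟨n, m, hm, he⟩ := exists_isIntegralElem_pow_eq_sum φ₂ ψ p (fun i => φ₁ (y i))
    (fun i => b i ^ p ^ k) hb' (x ^ p ^ k) (by
      rw [map_pow, hx, sum_pow_char_pow]
      exact Finset.sum_congr rfl fun i _ => by rw [mul_pow, hy]; rfl)
  refine ⟨k + n, fun i => y i ^ p ^ n, m, hm, ?_⟩
  rw [pow_add, pow_mul, he]
  simp only [map_pow]

end DrinfeldForms

theorem mainTheorem4 (F : Type*) [Field F] [Finite F]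
    (K : Type*) [Field K] [Algebra F[X] K] [IsFractionRing F[X] K]
    (L : Type*) [Field L] [Algebra (DrinfeldForms.R K) L] :
    (¬ ∃ (s : ℕ) (lam b : Fin s → L),
      (∀ i, lam i ∈ perfectClosure (DrinfeldForms.FqT F K L) L) ∧
      (∀ i, b i ∈ algebraicClosure (DrinfeldForms.KU K L) L) ∧
      algebraMap (DrinfeldForms.R K) L (DrinfeldForms.ofSeries F K (DrinfeldForms.d F)) =
        ∑ i, lam i * b i) ∧
    (¬ ∃ (s : ℕ) (mu b' : Fin s → L),
      (∀ i, mu i ∈ perfectClosure (DrinfeldForms.KU K L) L) ∧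
      (∀ i, b' i ∈ algebraicClosure (DrinfeldForms.FqT F K L) L) ∧
      algebraMap (DrinfeldForms.R K) L (DrinfeldForms.ofSeries F K (DrinfeldForms.d F)) =
        ∑ i, mu i * b' i) := by
  obtain ⟨p, _⟩ := ExpChar.exists F
  have : ExpChar K p :=
    expChar_of_injective_ringHom ((algebraMap F[X] K).comp Polynomial.C).injective p
  have : ExpChar F⸨X⸩ p := expChar_of_injective_ringHom (HahnSeries.C : F →+* F⸨X⸩).injective p
  have : ExpChar K⸨X⸩ p := expChar_of_injective_ringHom (HahnSeries.C : K →+* K⸨X⸩).injective p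
  constructor
  · rintro ⟨s, lam, b, hlam, hb, heq⟩
    obtain ⟨n, y, m, hm, he⟩ := DrinfeldForms.exists_pow_eq_sum_of_mem_perfectClosure
      (DrinfeldForms.ofFqT F K) (DrinfeldForms.ofKU K) (algebraMap (DrinfeldForms.R K) L) p
      hlam hb heq
    choose z hz using fun i => DrinfeldForms.exists_eq_ofKU_of_isIntegralElem K (hm i)
    -- The coefficients in 𝔽_q((t)) are used only as elements of K((t)).
    refine DrinfeldForms.ofSeries_d_pow_ne_sum F K p n s z
      (fun i => DrinfeldForms.laurentMap ((algebraMap F[X] K).comp Polynomial.C) (y i)) ?_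
    rw [he]
    exact Finset.sum_congr rfl fun i _ => by rw [hz, mul_comm]; rfl
  · rintro ⟨s, mu, b', hmu, hb', heq⟩
    obtain ⟨n, y, m, hm, he⟩ := DrinfeldForms.exists_pow_eq_sum_of_mem_perfectClosure
      (DrinfeldForms.ofKU K) (DrinfeldForms.ofFqT F K) (algebraMap (DrinfeldForms.R K) L) p
      hmu hb' heq
    choose z hz using fun i => DrinfeldForms.exists_eq_C_of_ofFqT_isIntegralElem F K (hm i)
    refine DrinfeldForms.ofSeries_d_pow_ne_sum F K p n s y z ?_
    rw [he]
    exact Finset.sum_congr rfl fun i _ => by rw [hz]
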